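/- Order $\{0,1\}$ by $0<1$ and let $<_\ell$ be the lexicographic order on $\{0,1\}^*$: $u <_\ell v$ iff $u$ is a proper prefix of $v$, or $u = x0y$ and $v = x1z$ for some words $x,y,z$. A linear ordering is called dense if it has at least two elements and for all $x<y$ in it there is a $z$ in it with $x<z<y$; it has order type $\eta$ if it is isomorphic to $(\mathbb{Q},<)$. For a context-free grammar $G$ over $\{0,1\}$ with start symbol $A_0$ and a nonterminal $A$ of $G$, let $L(G,A)\subseteq\{0,1\}^*$ be the set of terminal words derivable from $A$, and let $L(G)=L(G,A_0)$. $G$ is a prefix grammar if, for every nonterminal $A$, no word of $L(G,A)$ is a proper prefix of another word of $L(G,A)$. **Theorem.** There is no algorithm that decides, for a context-free grammar $G$ over $\{0,1\}$, whether $(L(G),<_\ell)$ is dense, and there is no algorithm that decides, for a context-free grammar $G$ over $\{0,1\}$, whether the order type of $(L(G),<_\ell)$ is $\eta$. Both problems remain undecidable when the inputs are restricted to prefix grammars: there is no algorithm that, on every prefix grammar $G$ over $\{0,1\}$, halts and correctly tells whether $(L(G),<_\ell)$ is dense, and none that does so for the question whether the order type of $(L(G),<_\ell)$ is $\eta$ (whatever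 the algorithm does on grammars that are not prefix grammars). -/

import Mathlib

/-- A finite description of a context-free grammar over `{0,1}`: a start symbol and a finite list of
productions `A → u`. Nonterminals are named by natural numbers, the terminals `0`, `1` are `false`,
`true`. The set of nonterminals of the grammar consists of the start symbol and the finitely many
numbers that occur in productions; up to renaming nonterminals, every context-free grammar
over `{0,1}` has such a description. -/
abbrev GrammarCode : Type := ℕ × List (ℕ × List (Bool ⊕ ℕ))

namespace GrammarCode

/-- The letters on the right-hand side of a production: `inl` is a terminal, `inr` a nonterminal. -/
def toSymbol : Bool ⊕ ℕ → Symbol Bool ℕ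
  | .inl a => .terminal a
  | .inr A => .nonterminal A

/-- The context-free grammar described by a code. -/
def toGrammar (c : GrammarCode) : ContextFreeGrammar Bool where
  NT := ℕ
  initial := c.1
  rules := (c.2.map fun r => (⟨r.1, r.2.map toSymbol⟩ : ContextFreeRule Bool ℕ)).toFinset

end GrammarCode

/-- The language `L(G, A)` generated from a nonterminal `A`. -/
def ContextFreeGrammar.languageFrom {T : Type} (G : ContextFreeGrammar T) (A : G.NT) :
    Language T :=
  {w : List T | G.Derives [Symbol.nonterminal A] (w.map Symbol.terminal)}

/-- A language is prefix-free if no word in it is a proper initial segment of another one. -/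
def IsPrefixFree {T : Type} (L : Language T) : Prop :=
  ∀ u ∈ L, ∀ v ∈ L, u <+: v → u = v

/-- All the languages `L(G, A)` are prefix-free. (A nonterminal that does not occur in the
productions generates the empty language, so names that are not in use impose no condition.) -/
def ContextFreeGrammar.IsPrefixGrammar {T : Type} (G : ContextFreeGrammar T) : Prop :=
  ∀ A : G.NT, IsPrefixFree (G.languageFrom A)

/-- `(L, <_ℓ)` is dense: it has at least two elements, and strictly between any two of
them there is a third one. The order on `List Bool` is the lexicographic one, with
`false < true` and with a proper initial segment of a word below the word. -/
def IsLexDense (L : Language Bool) : Prop :=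
  Nontrivial {w : List Bool // w ∈ L} ∧ DenselyOrdered {w : List Bool // w ∈ L}

/-- `(L, <_ℓ)` has order type `η`, that is, it is isomorphic to the ordering of the rationals. -/
def HasOrderTypeEta (L : Language Bool) : Prop :=
  Nonempty ({w : List Bool // w ∈ L} ≃o ℚ)

/-- Some algorithm decides `Q` for the inputs satisfying `P`: on every such input it halts
with the correct answer; nothing is required of it, not even halting, on other inputs. -/
def DecidableByAlgorithmOn {α : Type} [Primcodable α] (P Q : α → Prop) : Prop :=
  ∃ f : α →. Bool, Partrec f ∧ ∀ x, P x → ∃ b ∈ f x, (b = true ↔ Q x)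

/-! The halting problem reduces to the existence of a gap. A Turing machine configuration is stored
as two numbers, and a machine step becomes a pair of affine maps on residue classes. Halting is then
reachability of `(0, 0)` from `(s, i n)` in a fixed system `T` (`exists_undecidable_affine`).

A path is written as a list of pairs, alternately in normal and reversed order, and coded by
`unaryWord`. The left language checks every other step; the right language checks the remaining
steps, the start and the end. Each check compares nested unary blocks only, so both languages are
context-free, and they meet iff `(0, 0)` is reachable (`disjoint_iff_not_reaches`).

The final language is a lexicographic sum, over all `u = unaryWord xs`, of blocks `u0D < u10 < u110
< u111D`. Here `D` has type `η`, `u10` is present iff `u` is a left word, and `u110` iff `u` is a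
right word. The index words are prefix-free, so blocks do not interleave; they have no endpoints, so
the only possible gap is between `u10` and `u110`. If the two languages are disjoint, the sum is
dense without endpoints and Cantor's theorem gives `η`; a common word refutes both properties
(`isLexDense_blockLanguage_iff`, `hasOrderTypeEta_blockLanguage_iff`). Affine pieces are functions,
which keeps all nonterminals prefix-free; hence the restricted problems are undecidable, and so are
the unrestricted ones. -/

/-! ### Derivations in coded grammars. -/

/-- `Spells lang u w`: the word `w` is obtained from the sentential form `u` by replacing every
nonterminal `B` by a word of `lang B`. -/
def Spells {N : Type} (lang : N → Language Bool) : List (Bool ⊕ N) → List Bool → Prop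
  | [], w => w = []
  | .inl a :: u, w => ∃ v, Spells lang u v ∧ w = a :: v
  | .inr B :: u, w => ∃ x ∈ lang B, ∃ v, Spells lang u v ∧ w = x ++ v

namespace Spells

variable {N : Type} {lang : N → Language Bool}

theorem append_iff {u v : List (Bool ⊕ N)} {w : List Bool} :
    Spells lang (u ++ v) w ↔ ∃ x y, Spells lang u x ∧ Spells lang v y ∧ w = x ++ y := by
  induction u generalizing w with
  | nil => simp [Spells]
  | cons s u ih =>
    rcases s with a | B
    · simp only [List.cons_append, Spells, ih]
      constructor
      · rintro ⟨_, ⟨x, y, hx, hy, rfl⟩, rfl⟩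
        exact ⟨a :: x, y, ⟨x, hx, rfl⟩, hy, rfl⟩
      · rintro ⟨_, y, ⟨x, hx, rfl⟩, hy, rfl⟩
        exact ⟨x ++ y, ⟨x, y, hx, hy, rfl⟩, rfl⟩
    · simp only [List.cons_append, Spells, ih]
      constructor
      · rintro ⟨z, hz, _, ⟨x, y, hx, hy, rfl⟩, rfl⟩
        exact ⟨z ++ x, y, ⟨z, hz, x, hx, rfl⟩, hy, by simp⟩
      · rintro ⟨_, y, ⟨z, hz, x, hx, rfl⟩, hy, rfl⟩
        exact ⟨z, hz, x ++ y, ⟨x, y, hx, hy, rfl⟩, by simp⟩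

theorem map_inl_iff {l w : List Bool} : Spells lang (l.map Sum.inl) w ↔ w = l := by
  induction l generalizing w with
  | nil => simp [Spells]
  | cons a l ih => simp [Spells, ih]

theorem singleton_iff {B : N} {w : List Bool} : Spells lang [.inr B] w ↔ w ∈ lang B := by
  simp [Spells]

theorem map_right {M : Type} {f : M → N} {u : List (Bool ⊕ M)} {w : List Bool} :
    Spells lang (u.map (Sum.map id f)) w ↔ Spells (fun B => lang (f B)) u w := by
  induction u generalizing w with
  | nil => simp [Spells]
  | cons s u ih => rcases s with a | B <;> simp [Spells, ih]

end Spells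

namespace GrammarCode

variable {c : GrammarCode}

theorem toSymbol_injective : Function.Injective toSymbol := by
  rintro (a | A) (b | B) h <;> simp_all [toSymbol]

theorem mem_rules {r : ContextFreeRule Bool ℕ} :
    r ∈ c.toGrammar.rules ↔ ∃ p ∈ c.2, (⟨p.1, p.2.map toSymbol⟩ : ContextFreeRule Bool ℕ) = r := by
  change r ∈ (c.2.map fun r => (⟨r.1, r.2.map toSymbol⟩ : ContextFreeRule Bool ℕ)).toFinset ↔ _
  rw [List.mem_toFinset, List.mem_map]

theorem exists_map_toSymbol (u : List (Symbol Bool ℕ)) :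
    ∃ v : List (Bool ⊕ ℕ), u = v.map toSymbol := by
  induction u with
  | nil => exact ⟨[], rfl⟩
  | cons s u ih =>
    obtain ⟨v, rfl⟩ := ih
    rcases s with a | A
    · exact ⟨.inl a :: v, rfl⟩
    · exact ⟨.inr A :: v, rfl⟩

theorem map_terminal_eq (w : List Bool) :
    (w.map Symbol.terminal : List (Symbol Bool ℕ)) = (w.map Sum.inl).map toSymbol := by
  simp [toSymbol]

/-- A family of languages that is closed under the productions contains the generated one. -/
theorem languageFrom_le {lang : ℕ → Language Bool}
    (h : ∀ p ∈ c.2, ∀ w, Spells lang p.2 w → w ∈ lang p.1) (A : ℕ) :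
    ∀ w ∈ c.toGrammar.languageFrom A, w ∈ lang A := by
  intro w hw
  have key : ∀ u : List (Symbol Bool ℕ), c.toGrammar.Derives u (w.map Symbol.terminal) →
      ∀ v, u = v.map toSymbol → Spells lang v w := by
    intro u hu
    induction hu using Relation.ReflTransGen.head_induction_on with
    | refl =>
      intro v hv
      rw [← (List.map_injective_iff.2 toSymbol_injective) ((map_terminal_eq w).symm.trans hv)]
      exact Spells.map_inl_iff.2 rfl
    | head hstep _ ih =>
      rintro v hv
      obtain ⟨r, hr, hrw⟩ := hstep
      obtain ⟨p, hp, rfl⟩ := mem_rules.1 hr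
      obtain ⟨x, y, hx, hy⟩ := hrw.exists_parts
      obtain ⟨x, rfl⟩ := exists_map_toSymbol x
      obtain ⟨y, rfl⟩ := exists_map_toSymbol y
      have hv' : v = x ++ [.inr p.1] ++ y := by
        apply List.map_injective_iff.2 toSymbol_injective
        rw [List.map_append, List.map_append]
        exact hv.symm.trans hx
      have := ih (x ++ p.2 ++ y) (by rw [List.map_append, List.map_append]; exact hy)
      -- The first rewriting step is undone: the part of the word spelled by the right-hand side
      -- `p.2` lies in `lang p.1` by closure.
      rw [Spells.append_iff] at this
      obtain ⟨a, b, hab, hb, rfl⟩ := this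
      rw [Spells.append_iff] at hab
      obtain ⟨a, d, ha, hd, rfl⟩ := hab
      rw [hv', Spells.append_iff]
      refine ⟨_, b, Spells.append_iff.2 ⟨a, d, ha, ?_, rfl⟩, hb, rfl⟩
      exact Spells.singleton_iff.2 (h p hp d hd)
  exact Spells.singleton_iff.1 (key _ hw [.inr A] rfl)

/-- The generated languages are closed under the productions. -/
theorem mem_languageFrom_of_spells {A : ℕ} {u : List (Bool ⊕ ℕ)} (h : (A, u) ∈ c.2)
    {w : List Bool} (hw : Spells (c.toGrammar.languageFrom) u w) :
    w ∈ c.toGrammar.languageFrom A := by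
  have key : ∀ (u : List (Bool ⊕ ℕ)) (w : List Bool), Spells (c.toGrammar.languageFrom) u w →
      c.toGrammar.Derives (u.map toSymbol) (w.map Symbol.terminal) := by
    intro u
    induction u with
    | nil => rintro w rfl; exact ContextFreeGrammar.Derives.refl []
    | cons s u ih =>
      rcases s with a | B
      · rintro w ⟨v, hv, rfl⟩
        exact (ih v hv).append_left [Symbol.terminal a]
      · rintro w ⟨x, hx, v, hv, rfl⟩
        have h1 := ContextFreeGrammar.Derives.append_right (g := c.toGrammar) hx (u.map toSymbol)
        have h2 := (ih v hv).append_left (x.map Symbol.terminal)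
        rw [List.map_append]
        exact h1.trans h2
  refine Relation.ReflTransGen.head ⟨⟨A, u.map toSymbol⟩, mem_rules.2 ⟨_, h, rfl⟩, ?_⟩ (key u w hw)
  exact ContextFreeRule.Rewrites.input_output

end GrammarCode

/-! ### Turing machines as affine systems on pairs of numbers. -/

/-- The affine map `(modulus + 1) * k + residue ↦ slope * k + offset` on a residue class. -/
structure AffinePiece where
  modulus : ℕ
  residue : ℕ
  slope : ℕ
  offset : ℕ

/-- The graph of an affine map on a residue class. -/
def AffinePiece.Rel (p : AffinePiece) (x y : ℕ) : Prop :=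
  ∃ k, x = (p.modulus + 1) * k + p.residue ∧ y = p.slope * k + p.offset

theorem AffinePiece.Rel.right_unique {p : AffinePiece} {x y z : ℕ} (hy : p.Rel x y)
    (hz : p.Rel x z) : y = z := by
  obtain ⟨k, rfl, rfl⟩ := hy
  obtain ⟨l, h, rfl⟩ := hz
  have : k = l := Nat.eq_of_mul_eq_mul_left (Nat.succ_pos _) (Nat.add_right_cancel h)
  rw [this]

/-- One step of a system of pairs of affine maps acting on pairs of numbers. -/
def AffineStep (T : List (AffinePiece × AffinePiece)) (x y : ℕ × ℕ) : Prop :=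
  ∃ t ∈ T, t.1.Rel x.1 y.1 ∧ t.2.Rel x.2 y.2

namespace Turing

section ListBlank

variable {Γ : Type*} [Inhabited Γ]

/-- The number with the given digits in base `b`, least significant digit first. -/
def digitSum (b : ℕ) (d : Γ → ℕ) (l : List Γ) : ℕ :=
  l.foldr (fun a n => d a + b * n) 0

theorem digitSum_append_blanks {b : ℕ} {d : Γ → ℕ} (hd : d default = 0) (l : List Γ) (n : ℕ) :
    digitSum b d (l ++ List.replicate n default) = digitSum b d l := by
  induction l with
  | nil =>
    induction n with
    | zero => rfl
    | succ n ih =>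
      rw [List.nil_append] at ih
      simp [digitSum, List.replicate_succ, hd]
      right
      exact ih
  | cons a l ih => simp only [digitSum, List.cons_append, List.foldr_cons] at ih ⊢; rw [ih]

/-- The number represented by a half-tape; the blank is the digit `0`. -/
def ListBlank.value (b : ℕ) (d : Γ → ℕ) (hd : d default = 0) (L : ListBlank Γ) : ℕ :=
  L.liftOn (digitSum b d) (by rintro l _ ⟨n, rfl⟩; exact (digitSum_append_blanks hd l n).symm)

theorem ListBlank.value_mk {b : ℕ} {d : Γ → ℕ} (hd : d default = 0) (l : List Γ) :
    (ListBlank.mk l).value b d hd = digitSum b d l := rfl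

theorem ListBlank.value_cons {b : ℕ} {d : Γ → ℕ} (hd : d default = 0) (a : Γ) (L : ListBlank Γ) :
    (L.cons a).value b d hd = d a + b * L.value b d hd :=
  L.induction_on fun _ => rfl

end ListBlank

theorem exists_digits (Γ : Type*) [Inhabited Γ] [Finite Γ] :
    ∃ (b : ℕ) (d : Γ → ℕ), Function.Injective d ∧ d default = 0 ∧ ∀ a, d a < b + 1 := by
  classical
  obtain ⟨n, ⟨e⟩⟩ := Finite.exists_equiv_fin Γ
  refine ⟨n, fun a => if a = default then 0 else e a + 1, fun x y h => ?_, by simp, fun a => ?_⟩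
  · by_cases hx : x = default <;> by_cases hy : y = default <;> simp [hx, hy] at h ⊢
    exact e.injective (Fin.ext h)
  · have := (e a).2
    dsimp only
    split_ifs <;> omega

/-- Codes are positive so that no configuration with state in `S` is represented by `(0, 0)`, which
is reserved for halting. -/
theorem exists_state_codes {Λ : Type*} (S : Finset Λ) :
    ∃ (n : ℕ) (e : Λ → ℕ), Set.InjOn e S ∧ ∀ q ∈ S, 0 < e q ∧ e q < n + 1 := by
  classical
  refine ⟨S.card, fun q => if h : q ∈ S then S.equivFin ⟨q, h⟩ + 1 else 0, ?_, ?_⟩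
  · intro x hx y hy h
    have hx' : x ∈ S := hx
    have hy' : y ∈ S := hy
    simp only [hx', hy', dif_pos] at h
    have := S.equivFin.injective (Fin.ext (Nat.succ_injective h))
    exact congrArg Subtype.val this
  · intro q hq
    have := (S.equivFin ⟨q, hq⟩).2
    simp only [hq, dif_pos]
    omega

theorem eq_of_mul_add_eq {n a b r s : ℕ} (hr : r < n) (hs : s < n) (h : n * a + r = n * b + s) :
    a = b ∧ r = s := by
  have h1 := congrArg (· / n) h
  have h2 := congrArg (· % n) h
  have hn : 0 < n := by omega
  simp only [Nat.mul_add_div hn, Nat.div_eq_of_lt hr, Nat.div_eq_of_lt hs, Nat.mul_add_mod,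
    Nat.mod_eq_of_lt hr, Nat.mod_eq_of_lt hs] at h1 h2
  exact ⟨by simpa using h1, h2⟩

namespace TM0

variable {Γ Λ : Type*}

/-- The transition of an affine system for state `q`, symbol `a` under the head and symbol `c` to
the left of it. -/
def transition [Inhabited Λ] (M : Machine Γ Λ) (b n : ℕ) (d : Γ → ℕ) (e : Λ → ℕ) (q : Λ) (a c : Γ) :
    AffinePiece × AffinePiece :=
  -- Here `n * b + n + b + 1 = (n + 1) * (b + 1)`. Hence the residue of the left number reveals the
  -- state and the symbol `c`, the residue of the right number reveals `a`, and the quotients are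
  -- the values of the remaining half-tapes. A halting transition maps everything to `(0, 0)`.
  match M q a with
  | none => (⟨n * b + n + b, (n + 1) * d c + e q, 0, 0⟩, ⟨b, d a, 0, 0⟩)
  | some (q', .move .left) =>
      (⟨n * b + n + b, (n + 1) * d c + e q, n + 1, e q'⟩,
        ⟨b, d a, (b + 1) * (b + 1), d c + (b + 1) * d a⟩)
  | some (q', .move .right) =>
      (⟨n * b + n + b, (n + 1) * d c + e q, (n + 1) * ((b + 1) * (b + 1)),
          (n + 1) * (d a + (b + 1) * d c) + e q'⟩,
        ⟨b, d a, 1, 0⟩)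
  | some (q', .write g) =>
      (⟨n * b + n + b, (n + 1) * d c + e q, (n + 1) * (b + 1), (n + 1) * d c + e q'⟩,
        ⟨b, d a, b + 1, d g⟩)

/-- The pair of numbers that represents a configuration. -/
def Cfg.toPair [Inhabited Γ] (b n : ℕ) (d : Γ → ℕ) (hd : d default = 0)
    (e : Λ → ℕ) (x : Cfg Γ Λ) : ℕ × ℕ :=
  ((n + 1) * x.Tape.left.value (b + 1) d hd + e x.q, x.Tape.right₀.value (b + 1) d hd)

theorem transition_domain [Inhabited Λ] (M : Machine Γ Λ) (b n : ℕ) (d : Γ → ℕ)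
    (e : Λ → ℕ) (q : Λ) (a c : Γ) :
    let t := transition M b n d e q a c
    t.1.modulus = n * b + n + b ∧ t.1.residue = (n + 1) * d c + e q ∧
      t.2.modulus = b ∧ t.2.residue = d a := by
  intro t
  simp only [t, transition]
  split <;> exact ⟨rfl, rfl, rfl, rfl⟩

theorem Cfg.toPair_mk' [Inhabited Γ] {b n : ℕ} {d : Γ → ℕ} (hd : d default = 0) {e : Λ → ℕ} {q : Λ}
    {L R : ListBlank Γ} :
    Cfg.toPair b n d hd e ⟨q, Tape.mk' L R⟩ =
      ((n + 1) * L.value (b + 1) d hd + e q, R.value (b + 1) d hd) := by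
  simp [Cfg.toPair]

theorem transition_rel_step [Inhabited Γ] [Inhabited Λ] (M : Machine Γ Λ) (b n : ℕ)
    {d : Γ → ℕ} (hd : d default = 0)
    (e : Λ → ℕ) (q : Λ) (a c : Γ) (L R : ListBlank Γ) :
    let t := transition M b n d e q a c
    let z : Cfg Γ Λ := ⟨q, Tape.mk' (L.cons c) (R.cons a)⟩
    let y := ((step M z).map (Cfg.toPair b n d hd e)).getD (0, 0)
    t.1.Rel (z.toPair b n d hd e).1 y.1 ∧ t.2.Rel (z.toPair b n d hd e).2 y.2 := by
  intro t z y
  have hx1 : (z.toPair b n d hd e).1 =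
      (n * b + n + b + 1) * L.value (b + 1) d hd + ((n + 1) * d c + e q) := by
    simp only [z, Cfg.toPair_mk', ListBlank.value_cons]; ring
  have hx2 : (z.toPair b n d hd e).2 = (b + 1) * R.value (b + 1) d hd + d a := by
    simp only [z, Cfg.toPair_mk', ListBlank.value_cons]; ring
  have hhead : (Tape.mk' (L.cons c) (R.cons a)).1 = a := by simp
  rw [hx1, hx2]
  simp only [t, y, z, transition, step, hhead]
  rcases M q a with _ | ⟨q', (_ | _) | g⟩
  · exact ⟨⟨_, rfl, by simp⟩, ⟨_, rfl, by simp⟩⟩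
  · simp only [Option.map_some, Option.getD_some, Tape.move_left_mk', ListBlank.tail_cons,
      ListBlank.head_cons, Cfg.toPair_mk', ListBlank.value_cons]
    exact ⟨⟨_, rfl, rfl⟩, ⟨_, rfl, by ring⟩⟩
  · simp only [Option.map_some, Option.getD_some, Tape.move_right_mk', ListBlank.tail_cons,
      ListBlank.head_cons, Cfg.toPair_mk', ListBlank.value_cons]
    exact ⟨⟨_, rfl, by ring⟩, ⟨_, rfl, by ring⟩⟩
  · simp only [Option.map_some, Option.getD_some, Tape.write_mk', ListBlank.tail_cons,
      Cfg.toPair_mk', ListBlank.value_cons]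
    exact ⟨⟨_, rfl, by ring⟩, ⟨_, rfl, by ring⟩⟩

/-- The affine system of a machine with states in `S`, including an idle step. -/
noncomputable def affineSystem [Inhabited Λ] [Fintype Γ] (M : Machine Γ Λ) (S : Finset Λ) (b n : ℕ)
    (d : Γ → ℕ) (e : Λ → ℕ) : List (AffinePiece × AffinePiece) :=
  -- Modulus `0 + 1`, residue `0`, slope `1`: the identity on all pairs. It later serves to pad
  -- paths.
  (⟨0, 0, 1, 0⟩, ⟨0, 0, 1, 0⟩) ::
    (S ×ˢ (Finset.univ : Finset (Γ × Γ))).toList.map fun s => transition M b n d e s.1 s.2.1 s.2.2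

theorem affineSystem_refl [Inhabited Λ] [Fintype Γ] (M : Machine Γ Λ) (S : Finset Λ) (b n : ℕ)
    (d : Γ → ℕ) (e : Λ → ℕ) (x : ℕ × ℕ) : AffineStep (affineSystem M S b n d e) x x :=
  ⟨_, List.mem_cons_self, ⟨x.1, by simp, by simp⟩, ⟨x.2, by simp, by simp⟩⟩

/-- The residues determine the state and both symbols, because digits and state codes are injective
and bounded. So apart from the idle step exactly one transition applies, and it mirrors the machine.
-/
theorem affineStep_toPair_iff [Inhabited Γ] [Inhabited Λ] [Fintype Γ] {M : Machine Γ Λ}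
    {S : Finset Λ} {b n : ℕ} {d : Γ → ℕ}
    (hd : d default = 0) {e : Λ → ℕ} (hinj : Function.Injective d) (hb : ∀ a, d a < b + 1)
    (einj : Set.InjOn e S) (hn : ∀ q ∈ S, e q < n + 1) {x : Cfg Γ Λ} (hx : x.q ∈ S) {y : ℕ × ℕ} :
    AffineStep (affineSystem M S b n d e) (x.toPair b n d hd e) y ↔
      y = x.toPair b n d hd e ∨ y = ((step M x).map (Cfg.toPair b n d hd e)).getD (0, 0) := by
  obtain ⟨q, tape⟩ := x
  obtain ⟨L, R, rfl⟩ := tape.exists_mk'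
  obtain ⟨c, L, rfl⟩ := L.exists_cons
  obtain ⟨a, R, rfl⟩ := R.exists_cons
  have key := transition_rel_step M b n hd e q a c L R
  constructor
  · rintro ⟨t, ht, h1, h2⟩
    rcases List.mem_cons.1 ht with rfl | ht
    · left
      obtain ⟨k, hk, hk'⟩ := h1
      obtain ⟨l, hl, hl'⟩ := h2
      ext
      · rw [hk, hk']
      · rw [hl, hl']
    · right
      obtain ⟨⟨q', a', c'⟩, hs, rfl⟩ := List.mem_map.1 ht
      have hq' : q' ∈ S := by simpa using hs
      obtain ⟨m1, r1, m2, r2⟩ := transition_domain M b n d e q' a' c'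
      have h1' := h1
      have h2' := h2
      obtain ⟨k, hk, -⟩ := h1'
      obtain ⟨l, hl, -⟩ := h2'
      simp only [m1, r1, Cfg.toPair_mk', ListBlank.value_cons] at hk
      simp only [m2, r2, Cfg.toPair_mk', ListBlank.value_cons] at hl
      have hk2 := eq_of_mul_add_eq (a := d c + (b + 1) * L.value (b + 1) d hd)
        (b := d c' + (b + 1) * k) (hn q hx) (hn q' hq') (by rw [hk]; ring)
      obtain rfl : q = q' := einj hx hq' hk2.2
      obtain rfl : c = c' := hinj (eq_of_mul_add_eq (a := L.value (b + 1) d hd) (b := k)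
        (hb c) (hb c') (by linarith [hk2.1])).2
      obtain rfl : a = a' := hinj (eq_of_mul_add_eq (a := R.value (b + 1) d hd) (b := l)
        (hb a) (hb a') (by linarith)).2
      exact Prod.ext (h1.right_unique key.1) (h2.right_unique key.2)
  · rintro (rfl | rfl)
    · exact affineSystem_refl M S b n d e _
    · refine ⟨_, List.mem_cons_of_mem _ (List.mem_map.2 ⟨(q, a, c), ?_, rfl⟩), key.1, key.2⟩
      simpa using hx

/-- Halting of a Turing machine is reachability of `(0, 0)` in an affine system. -/
theorem exists_affine_simulation [Inhabited Γ] [Inhabited Λ] [Finite Γ] (M : Machine Γ Λ)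
    (S : Finset Λ) (hS : Supports M (S : Set Λ)) :
    ∃ (T : List (AffinePiece × AffinePiece)) (s b : ℕ) (d : Γ → ℕ), (∀ x, AffineStep T x x) ∧
      ∀ l, (eval M l).Dom ↔ Relation.ReflTransGen (AffineStep T) (s, digitSum b d l) (0, 0) := by
  have := Fintype.ofFinite Γ
  obtain ⟨b, d, hinj, hd, hb⟩ := exists_digits Γ
  obtain ⟨n, e, einj, he⟩ := exists_state_codes S
  refine ⟨affineSystem M S b n d e, e default, b + 1, d, affineSystem_refl M S b n d e,
    fun l => ?_⟩
  have hstart : (e default, digitSum (b + 1) d l) = (init (Λ := Λ) l).toPair b n d hd e := by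
    rw [init, Tape.mk₁, Tape.mk₂, Cfg.toPair_mk', ListBlank.value_mk, ListBlank.value_mk]
    simp [digitSum]
  rw [hstart]
  have hiff : ∀ {x : Cfg Γ Λ}, x.q ∈ S → ∀ {y}, _ := fun {x} hx {y} =>
    affineStep_toPair_iff (M := M) hd hinj hb einj (fun q hq => (he q hq).2) hx (y := y)
  constructor
  · intro h
    obtain ⟨z, hz⟩ := Part.dom_iff_mem.1 ((Part.map_Dom _ _).mp h)
    obtain ⟨hreach, hnone⟩ := StateTransition.mem_eval.1 hz
    have hpath : ∀ x : Cfg Γ Λ, StateTransition.Reaches (step M) x z → x.q ∈ S →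
        Relation.ReflTransGen (AffineStep (affineSystem M S b n d e))
          (x.toPair b n d hd e) (0, 0) := by
      intro x hx
      induction hx using Relation.ReflTransGen.head_induction_on with
      | refl =>
        intro hq
        exact .single ((hiff hq).2 (Or.inr (by rw [hnone]; rfl)))
      | head hab _ ih =>
        intro hq
        refine .head ((hiff hq).2 (Or.inr ?_)) (ih (step_supports M hS hab hq))
        rw [Option.mem_def.1 hab]; rfl
    exact hpath _ hreach hS.1
  · intro h
    refine (Part.map_Dom _ _).mpr ?_
    have hpath : ∀ p : ℕ × ℕ,
        Relation.ReflTransGen (AffineStep (affineSystem M S b n d e)) p (0, 0) →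
        ∀ x : Cfg Γ Λ, p = x.toPair b n d hd e → x.q ∈ S →
          (StateTransition.eval (step M) x).Dom := by
      intro p hp
      induction hp using Relation.ReflTransGen.head_induction_on with
      | refl =>
        intro x hx hq
        -- A configuration cannot equal `(0, 0)`, since its state code is positive.
        have := congrArg Prod.fst hx
        have := (he _ hq).1
        simp only [Cfg.toPair] at *
        omega
      | head hab _ ih =>
        rintro x rfl hq
        -- An idle step stays at `x`; any other step either shows that `x` halts or follows the
        -- machine.
        rcases (hiff hq).1 hab with h | h
        · exact ih x h hq
        · rcases hx : step M x with _ | x'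
          · exact Part.dom_iff_mem.2 ⟨x, StateTransition.mem_eval.2 ⟨.refl, hx⟩⟩
          · rw [StateTransition.reaches_eval (Relation.ReflTransGen.single hx)]
            exact ih x' (by rw [h, hx]; rfl) (step_supports M hS hx hq)
    exact hpath _ h _ rfl hS.1

end TM0

end Turing

/-! ### From partial recursive functions to affine systems. -/

namespace Turing

section
open PartrecToTM2

/-- Inputs are encoded as powers of two because their binary expansions are uniform, which makes the
number on the initial tape an explicit recursion in `n`. -/
theorem PartrecToTM2.trNat_two_pow (n : ℕ) :
    trNat (2 ^ n) = List.replicate n Γ'.bit0 ++ [Γ'.bit1] := by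
  have key : ((2 ^ n : ℕ) : Num) = Num.pos ((PosNum.bit0)^[n] PosNum.one) := by
    induction n with
    | zero => rfl
    | succ n ih =>
      rw [pow_succ, Nat.mul_comm, Function.iterate_succ_apply']
      have : ((2 * 2 ^ n : ℕ) : Num) = Num.bit0 ((2 ^ n : ℕ) : Num) := by
        rw [← Num.bit0_of_bit0, Nat.cast_mul, Nat.cast_ofNat, two_mul]
      rw [this, ih]; rfl
  rw [trNat, key, trNum]
  clear key
  induction n with
  | zero => rfl
  | succ n ih => rw [Function.iterate_succ_apply', trPosNum, ih]; rfl

theorem digitSum_replicate {Γ : Type*} (b : ℕ) (d : Γ → ℕ) (a : Γ) (n : ℕ) :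
    digitSum b d (List.replicate n a) = n.rec 0 fun _ m => d a + b * m := by
  induction n with
  | zero => rfl
  | succ n ih => simp only [List.replicate_succ, digitSum, List.foldr_cons] at ih ⊢; rw [ih]

theorem computable_digitSum_trInit (b : ℕ) (d : TM2to1.Γ' K' (fun _ => Γ') → ℕ) :
    Computable fun n : ℕ => digitSum b d (TM2to1.trInit K'.main (trList [2 ^ n])) := by
  set φ : Γ' → TM2to1.Γ' K' (fun _ => Γ') :=
    fun a => (false, Function.update (fun _ => none) K'.main (some a))
  have h : ∀ n : ℕ, digitSum b d (TM2to1.trInit K'.main (trList [2 ^ n])) =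
      d (true, (φ Γ'.cons).2) +
        b * (d (φ Γ'.bit1) + b * n.rec 0 fun _ m => d (φ Γ'.bit0) + b * m) := by
    intro n
    -- The reversed input ends up on the tape; `true` in the first cell marks the bottom of the
    -- stacks.
    have : TM2to1.trInit (Γ := fun _ => Γ') K'.main (trList [2 ^ n]) =
        (true, (φ Γ'.cons).2) :: φ Γ'.bit1 :: List.replicate n (φ Γ'.bit0) := by
      have hrev : (trList [2 ^ n]).reverse = Γ'.cons :: Γ'.bit1 :: List.replicate n Γ'.bit0 := by
        simp [trNat_two_pow]
      have hmap : (trList [2 ^ n]).reverse.map φ =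
          φ Γ'.cons :: φ Γ'.bit1 :: List.replicate n (φ Γ'.bit0) := by
        rw [hrev, List.map_cons, List.map_cons, List.map_replicate]
      exact congrArg (fun l => (true, l.headI.2) :: l.tail) hmap
    rw [this, ← digitSum_replicate]
    rfl
  simp only [h]
  have hrec : Primrec fun n : ℕ => (n.rec 0 fun _ m => d (φ Γ'.bit0) + b * m : ℕ) :=
    Primrec.nat_rec₁ 0 (Primrec.nat_add.comp (Primrec.const _)
      (Primrec.nat_mul.comp (Primrec.const _) Primrec.snd)).to₂
  exact (Primrec.nat_add.comp (Primrec.const _) (Primrec.nat_mul.comp (Primrec.const _)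
    (Primrec.nat_add.comp (Primrec.const _)
      (Primrec.nat_mul.comp (Primrec.const _) hrec)))).to_comp

/-- `g` searches for the exponent of its input and then runs `f` on it. -/
theorem exists_partrec_two_pow {f : ℕ →. ℕ} (hf : Partrec f) :
    ∃ g : ℕ →. ℕ, Partrec g ∧ ∀ n, (g (2 ^ n)).Dom ↔ (f n).Dom := by
  refine ⟨fun m => (Nat.rfind fun n => Part.some (decide (2 ^ n = m))).bind f, ?_, fun n => ?_⟩
  · refine Partrec.bind (Partrec.rfind ?_) (hf.comp Computable.snd).to₂
    have hpow : Primrec fun n : ℕ => 2 ^ n := by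
      have : Primrec fun n : ℕ => (n.rec 1 fun _ m => 2 * m : ℕ) :=
        Primrec.nat_rec₁ 1 (Primrec.nat_mul.comp (Primrec.const _) Primrec.snd).to₂
      refine this.of_eq fun n => ?_
      induction n with
      | zero => rfl
      | succ n ih => rw [pow_succ, mul_comm, ← ih]
    exact (Primrec.eq.decide.comp (hpow.comp Primrec.snd) Primrec.fst).to_comp.partrec.to₂
  · have : Nat.rfind (fun k => Part.some (decide (2 ^ k = 2 ^ n))) = Part.some n := by
      refine Part.eq_some_iff.2 (Nat.mem_rfind.2 ⟨by simp, fun {m} hm => ?_⟩)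
      simp [hm.ne]
    exact iff_of_eq ((congrArg (fun p : Part ℕ => (p.bind f).Dom) this).trans
      (congrArg Part.Dom (Part.bind_some n f)))

/-- Every partial recursive function is halting-equivalent to an affine system started on
computable data. -/
theorem exists_affine_of_partrec {f : ℕ →. ℕ} (hf : Partrec f) :
    ∃ (T : List (AffinePiece × AffinePiece)) (s : ℕ) (i : ℕ → ℕ), (∀ x, AffineStep T x x) ∧
      Computable i ∧
      ∀ n, (f n).Dom ↔ Relation.ReflTransGen (AffineStep T) (s, i n) (0, 0) := by
  obtain ⟨g, hg, hgf⟩ := exists_partrec_two_pow hf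
  obtain ⟨c, hc⟩ := ToPartrec.Code.exists_code (Nat.Partrec'.part_iff₁.2 hg)
  -- The machine starts in the default state, so the default must be the entry point of the code
  -- `c`.
  let hq : Inhabited Λ' := ⟨trNormal c Cont'.halt⟩
  have hsupp : TM2.Supports tr (codeSupp c Cont'.halt) := tr_supports c Cont'.halt
  have : Finite K' := Finite.of_surjective
    (fun i : Fin 4 => ![K'.main, K'.rev, K'.aux, K'.stack] i)
    (by rintro (_ | _ | _ | _) <;> [exact ⟨0, rfl⟩; exact ⟨1, rfl⟩; exact ⟨2, rfl⟩; exact ⟨3, rfl⟩])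
  have : Finite (TM2to1.Γ' K' fun _ => Γ') := inferInstanceAs (Finite (Bool × (K' → Option Γ')))
  obtain ⟨T, s, b, d, hrefl, hT⟩ := TM0.exists_affine_simulation _ _
    (TM1to0.tr_supports _ (TM2to1.tr_supports tr hsupp))
  refine ⟨T, s, _, hrefl, computable_digitSum_trInit b d, fun n => ?_⟩
  rw [← hT, TM1to0.tr_eval]
  refine .trans ?_ (TM2to1.tr_eval_dom tr K'.main (trList [2 ^ n])).symm
  have hinit : TM2.init K'.main (trList [2 ^ n]) = PartrecToTM2.init c [2 ^ n] := by
    refine congrArg (TM2.Cfg.mk _ _) (funext fun k => ?_)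
    cases k <;> rfl
  have hdom : (TM2.eval tr K'.main (trList [2 ^ n])).Dom ↔ (c.eval [2 ^ n]).Dom :=
    iff_of_eq ((congrArg (fun x => (StateTransition.eval (TM2.step tr) x).Dom) hinit).trans
      (congrArg Part.Dom (PartrecToTM2.tr_eval c [2 ^ n])))
  rw [hdom, ← hgf]
  exact iff_of_eq (congrArg Part.Dom (hc ⟨[2 ^ n], rfl⟩)).symm

end

end Turing

/-- Apply the simulation to the universal function that decodes `n` as a program and runs it on
input `0`. One system `T` serves all instances; only the start value `i n` varies. -/
theorem exists_undecidable_affine :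
    ∃ (T : List (AffinePiece × AffinePiece)) (s : ℕ) (i : ℕ → ℕ), (∀ x, AffineStep T x x) ∧
      Computable i ∧
      ¬ ComputablePred fun n => Relation.ReflTransGen (AffineStep T) (s, i n) (0, 0) := by
  have hf : Partrec fun n : ℕ =>
      ((Encodable.decode (α := Nat.Partrec.Code) n : Option _) : Part _).bind
        fun c => Nat.Partrec.Code.eval c 0 :=
    (Computable.ofOption Computable.decode).bind
      (Nat.Partrec.Code.eval_part.comp Computable.snd (Computable.const 0)).to₂
  obtain ⟨T, s, i, hrefl, hi, h⟩ := Turing.exists_affine_of_partrec hf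
  refine ⟨T, s, i, hrefl, hi, fun hdec => ComputablePred.halting_problem 0 ?_⟩
  refine ComputablePred.computable_of_manyOneReducible
    ⟨fun c : Nat.Partrec.Code => Encodable.encode c, Computable.encode, fun c => ?_⟩ hdec
  rw [← h]
  simp

/-! ### Prefix-free languages and lexicographic sums of blocks. -/

namespace IsPrefixFree

theorem append_inj {T : Type} {L : Language T} (hL : IsPrefixFree L) {u v x y : List T}
    (hu : u ∈ L) (hv : v ∈ L) (h : u ++ x <+: v ++ y) : u = v ∧ x <+: y := by
  have h1 : u <+: v ++ y := (List.prefix_append u x).trans h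
  have : u = v := by
    rcases List.prefix_or_prefix_of_prefix h1 (List.prefix_append v y) with h | h
    · exact hL u hu v hv h
    · exact (hL v hv u hu h).symm
  subst this
  exact ⟨rfl, (List.prefix_append_right_inj u).1 h⟩

end IsPrefixFree

section Lex

theorem List.append_lt_append_left_iff (w x y : List Bool) : w ++ x < w ++ y ↔ x < y := by
  induction w with
  | nil => rfl
  | cons a w ih => simp [ih]

theorem List.append_lt_append_of_not_prefix {u v : List Bool} (huv : u < v) (h : ¬ u <+: v)
    (x y : List Bool) : u ++ x < v ++ y := by
  induction u generalizing v with
  | nil => simp at h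
  | cons a u ih =>
    rcases v with _ | ⟨b, v⟩
    · simp at huv
    · rw [List.cons_lt_cons_iff] at huv
      rw [List.cons_append, List.cons_append, List.cons_lt_cons_iff]
      rcases huv with hab | ⟨rfl, huv⟩
      · exact .inl hab
      · exact .inr ⟨rfl, ih huv (by simpa using h)⟩

/-- The regular language `(00 + 11)*01`, which has order type `η`. -/
inductive DenseWord : List Bool → Prop
  | base : DenseWord [false, true]
  | low {w} : DenseWord w → DenseWord (false :: false :: w)
  | high {w} : DenseWord w → DenseWord (true :: true :: w)

namespace DenseWord

/-- With `D` the set of dense words, `D` is the ordered sum `00D < 01 < 11D`; this and the next two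
lemmas are inductions along that splitting. -/
theorem exists_lt {x : List Bool} (hx : DenseWord x) : ∃ y, DenseWord y ∧ y < x := by
  induction hx with
  | base => exact ⟨_, low base, by decide⟩
  | low _ ih => obtain ⟨y, hy, h⟩ := ih; exact ⟨_, low hy, by simpa [List.cons_lt_cons_iff] using h⟩
  | high _ _ => exact ⟨_, base, by simp [List.cons_lt_cons_iff]⟩

theorem exists_gt {x : List Bool} (hx : DenseWord x) : ∃ y, DenseWord y ∧ x < y := by
  induction hx with
  | base => exact ⟨_, high base, by decide⟩
  | low _ _ => exact ⟨_, base, by simp [List.cons_lt_cons_iff]⟩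
  | high _ ih => obtain ⟨y, hy, h⟩ := ih; exact ⟨_, high hy, by simpa [List.cons_lt_cons_iff] using h⟩

theorem exists_between {x y : List Bool} (hx : DenseWord x) (hy : DenseWord y) (h : x < y) :
    ∃ z, DenseWord z ∧ x < z ∧ z < y := by
  induction hx generalizing y with
  | base =>
    cases hy with
    | base => exact absurd h (lt_irrefl _)
    | low _ => exact absurd h (by simp [List.cons_lt_cons_iff]; try decide)
    | high hy =>
      obtain ⟨z, hz, hzy⟩ := hy.exists_lt
      exact ⟨_, high hz, by simp [List.cons_lt_cons_iff], by simpa [List.cons_lt_cons_iff] using hzy⟩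
  | low hx ih =>
    cases hy with
    | base =>
      obtain ⟨z, hz, hxz⟩ := hx.exists_gt
      exact ⟨_, low hz, by simpa [List.cons_lt_cons_iff] using hxz, by simp [List.cons_lt_cons_iff]⟩
    | low hy =>
      obtain ⟨z, hz, hxz, hzy⟩ := ih hy (by simpa [List.cons_lt_cons_iff] using h)
      exact ⟨_, low hz, by simpa [List.cons_lt_cons_iff] using hxz,
        by simpa [List.cons_lt_cons_iff] using hzy⟩
    | high _ =>
      exact ⟨_, base, by simp [List.cons_lt_cons_iff], by simp [List.cons_lt_cons_iff]⟩
  | high _ ih =>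
    cases hy with
    | base => exact absurd h (by simp [List.cons_lt_cons_iff]; try decide)
    | low _ => exact absurd h (by simp [List.cons_lt_cons_iff]; try decide)
    | high hy =>
      obtain ⟨z, hz, hxz, hzy⟩ := ih hy (by simpa [List.cons_lt_cons_iff] using h)
      exact ⟨_, high hz, by simpa [List.cons_lt_cons_iff] using hxz,
        by simpa [List.cons_lt_cons_iff] using hzy⟩

theorem isPrefixFree : IsPrefixFree {w | DenseWord w} := by
  intro u hu v hv h
  change DenseWord u at hu
  change DenseWord v at hv
  induction hu generalizing v with
  | base => cases hv <;> simp_all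
  | low _ ih =>
    cases hv with
    | low hv => rw [ih _ (by simpa using h) hv]
    | _ => simp at h
  | high _ ih =>
    cases hv with
    | high hv => rw [ih _ (by simpa using h) hv]
    | _ => simp at h

end DenseWord

/-- The words that may follow a word of the index set: a copy of `η` below and one above, and
between them one point for membership in each of two sets. -/
inductive BlockWord (inU inV : Prop) : List Bool → Prop
  | below {q} : DenseWord q → BlockWord inU inV (false :: q)
  | above {q} : DenseWord q → BlockWord inU inV (true :: true :: true :: q)
  | left : inU → BlockWord inU inV [true, false]
  | right : inV → BlockWord inU inV [true, true, false]

namespace BlockWord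

variable {inU inV : Prop}

theorem isPrefixFree : IsPrefixFree {w | BlockWord inU inV w} := by
  intro u hu v hv h
  change BlockWord inU inV u at hu
  change BlockWord inU inV v at hv
  cases hu with
  | below hu =>
    cases hv with
    | below hv => rw [DenseWord.isPrefixFree _ hu _ hv (by simpa using h)]
    | _ => simp at h
  | above hu =>
    cases hv with
    | above hv => rw [DenseWord.isPrefixFree _ hu _ hv (by simpa using h)]
    | _ => simp at h
  | left _ => cases hv <;> simp_all
  | right _ => cases hv <;> simp_all

theorem exists_lt {x : List Bool} (hx : BlockWord inU inV x) : ∃ y, BlockWord inU inV y ∧ y < x := by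
  cases hx with
  | below hx =>
    obtain ⟨y, hy, h⟩ := hx.exists_lt
    exact ⟨_, below hy, by simpa [List.cons_lt_cons_iff] using h⟩
  | _ => exact ⟨_, below .base, by simp [List.cons_lt_cons_iff]⟩

theorem exists_gt {x : List Bool} (hx : BlockWord inU inV x) : ∃ y, BlockWord inU inV y ∧ x < y := by
  cases hx with
  | above hx =>
    obtain ⟨y, hy, h⟩ := hx.exists_gt
    exact ⟨_, above hy, by simpa [List.cons_lt_cons_iff] using h⟩
  | _ => exact ⟨_, above .base, by simp [List.cons_lt_cons_iff]⟩

/-- The order is `0D < 10 < 110 < 111D`. Both outer copies are dense and endless, so only `10` and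
`110` can be neighbours, and `hUV` excludes their joint presence. -/
theorem exists_between (hUV : ¬ (inU ∧ inV)) {x y : List Bool} (hx : BlockWord inU inV x)
    (hy : BlockWord inU inV y) (h : x < y) : ∃ z, BlockWord inU inV z ∧ x < z ∧ z < y := by
  cases hx with
  | below hx =>
    cases hy with
    | below hy =>
      obtain ⟨z, hz, hxz, hzy⟩ := hx.exists_between hy (by simpa [List.cons_lt_cons_iff] using h)
      exact ⟨_, below hz, by simpa [List.cons_lt_cons_iff] using hxz,
        by simpa [List.cons_lt_cons_iff] using hzy⟩
    | _ =>
      obtain ⟨z, hz, hxz⟩ := hx.exists_gt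
      exact ⟨_, below hz, by simpa [List.cons_lt_cons_iff] using hxz,
        by simp [List.cons_lt_cons_iff]⟩
  | above hx =>
    cases hy with
    | above hy =>
      obtain ⟨z, hz, hxz, hzy⟩ := hx.exists_between hy (by simpa [List.cons_lt_cons_iff] using h)
      exact ⟨_, above hz, by simpa [List.cons_lt_cons_iff] using hxz,
        by simpa [List.cons_lt_cons_iff] using hzy⟩
    | _ => exact absurd h (by simp [List.cons_lt_cons_iff]; try decide)
  | left hu =>
    cases hy with
    | above hy =>
      obtain ⟨z, hz, hzy⟩ := hy.exists_lt
      exact ⟨_, above hz, by simp [List.cons_lt_cons_iff],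
        by simpa [List.cons_lt_cons_iff] using hzy⟩
    | right hv => exact absurd ⟨hu, hv⟩ hUV
    | _ => exact absurd h (by simp [List.cons_lt_cons_iff]; try decide)
  | right hv =>
    cases hy with
    | above hy =>
      obtain ⟨z, hz, hzy⟩ := hy.exists_lt
      exact ⟨_, above hz, by simp [List.cons_lt_cons_iff],
        by simpa [List.cons_lt_cons_iff] using hzy⟩
    | _ => exact absurd h (by simp [List.cons_lt_cons_iff]; try decide)

theorem not_between (x : List Bool) (hx : BlockWord inU inV x) (h1 : [true, false] < x)
    (h2 : x < [true, true, false]) : False := by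
  cases hx with
  | below _ => exact absurd h1 (by simp [List.cons_lt_cons_iff]; try decide)
  | above _ => exact absurd h2 (by simp [List.cons_lt_cons_iff]; try decide)
  | left _ => exact lt_irrefl _ h1
  | right _ => exact lt_irrefl _ h2

end BlockWord

/-- A lexicographic sum of blocks over a prefix-free index set `W`. -/
def blockLanguage (W U V : Language Bool) : Language Bool :=
  {w | ∃ u ∈ W, ∃ x, BlockWord (u ∈ U) (u ∈ V) x ∧ w = u ++ x}

section Blocks

variable {W U V : Language Bool}

theorem blockLanguage_isPrefixFree (hW : IsPrefixFree W) :
    IsPrefixFree (blockLanguage W U V) := by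
  rintro _ ⟨u, hu, x, hx, rfl⟩ _ ⟨v, hv, y, hy, rfl⟩ h
  obtain ⟨rfl, hxy⟩ := hW.append_inj hu hv h
  rw [BlockWord.isPrefixFree x hx y hy hxy]

/-- Distinct index words differ at some letter before either one ends, so whatever is appended does
not affect their comparison. -/
theorem lt_or_eq_of_append_lt (hW : IsPrefixFree W) {u v x y : List Bool} (hu : u ∈ W) (hv : v ∈ W)
    (h : u ++ x < v ++ y) : (∀ x y : List Bool, u ++ x < v ++ y) ∨ (u = v ∧ x < y) := by
  rcases lt_trichotomy u v with huv | rfl | huv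
  · exact .inl (List.append_lt_append_of_not_prefix huv fun hp => huv.ne (hW u hu v hv hp))
  · exact .inr ⟨rfl, (List.append_lt_append_left_iff _ _ _).1 h⟩
  · exact absurd h (lt_asymm (List.append_lt_append_of_not_prefix huv
      (fun hp => huv.ne (hW v hv u hu hp)) y x))

theorem blockLanguage_densely_ordered (hW : IsPrefixFree W) (hUV : ∀ u ∈ W, ¬ (u ∈ U ∧ u ∈ V)) :
    DenselyOrdered {w // w ∈ blockLanguage W U V} := by
  constructor
  rintro ⟨_, u, hu, x, hx, rfl⟩ ⟨_, v, hv, y, hy, rfl⟩ h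
  rcases lt_or_eq_of_append_lt hW hu hv h with h | ⟨rfl, hxy⟩
  -- Between different blocks a larger element of the lower block suffices.
  · obtain ⟨z, hz, hxz⟩ := hx.exists_gt
    exact ⟨⟨_, u, hu, z, hz, rfl⟩, (List.append_lt_append_left_iff _ _ _).2 hxz, h _ _⟩
  · obtain ⟨z, hz, hxz, hzy⟩ := hx.exists_between (hUV u hu) hy hxy
    exact ⟨⟨_, u, hu, z, hz, rfl⟩, (List.append_lt_append_left_iff _ _ _).2 hxz,
      (List.append_lt_append_left_iff _ _ _).2 hzy⟩

theorem blockLanguage_noMin : NoMinOrder {w // w ∈ blockLanguage W U V} := by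
  constructor
  rintro ⟨_, u, hu, x, hx, rfl⟩
  obtain ⟨z, hz, hzx⟩ := hx.exists_lt
  exact ⟨⟨_, u, hu, z, hz, rfl⟩, (List.append_lt_append_left_iff _ _ _).2 hzx⟩

theorem blockLanguage_noMax : NoMaxOrder {w // w ∈ blockLanguage W U V} := by
  constructor
  rintro ⟨_, u, hu, x, hx, rfl⟩
  obtain ⟨z, hz, hzx⟩ := hx.exists_gt
  exact ⟨⟨_, u, hu, z, hz, rfl⟩, (List.append_lt_append_left_iff _ _ _).2 hzx⟩

theorem blockLanguage_nonempty (hW : ∃ w, w ∈ W) : Nonempty {w // w ∈ blockLanguage W U V} :=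
  let ⟨_, hw⟩ := hW
  ⟨⟨_, _, hw, _, .below .base, rfl⟩⟩

theorem not_densely_ordered_blockLanguage (hW : IsPrefixFree W) {u : List Bool} (hu : u ∈ W)
    (hU : u ∈ U) (hV : u ∈ V) : ¬ DenselyOrdered {w // w ∈ blockLanguage W U V} := by
  intro h
  obtain ⟨⟨_, v, hv, x, hx, rfl⟩, h1, h2⟩ := h.dense
    ⟨u ++ [true, false], u, hu, _, .left hU, rfl⟩
    ⟨u ++ [true, true, false], u, hu, _, .right hV, rfl⟩
    ((List.append_lt_append_left_iff _ _ _).2 (by decide))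
  rcases lt_or_eq_of_append_lt hW hu hv h1 with h | ⟨rfl, h3⟩
  · exact lt_asymm h2 (h _ _)
  · exact hx.not_between _ h3 ((List.append_lt_append_left_iff _ _ _).1 h2)

theorem hasOrderTypeEta_blockLanguage_iff (hW : IsPrefixFree W) (hne : ∃ w, w ∈ W) :
    HasOrderTypeEta (blockLanguage W U V) ↔ ∀ u ∈ W, ¬ (u ∈ U ∧ u ∈ V) := by
  constructor
  · rintro ⟨e⟩ u hu ⟨hU, hV⟩
    refine not_densely_ordered_blockLanguage hW hu hU hV ⟨fun a b hab => ?_⟩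
    obtain ⟨c, hac, hcb⟩ := exists_between (e.lt_iff_lt.2 hab)
    exact ⟨e.symm c, e.lt_symm_apply.2 hac, e.symm_apply_lt.2 hcb⟩
  · intro h
    have := blockLanguage_densely_ordered hW h
    have := blockLanguage_noMin (W := W) (U := U) (V := V)
    have := blockLanguage_noMax (W := W) (U := U) (V := V)
    have := blockLanguage_nonempty (U := U) (V := V) hne
    -- Cantor's theorem on countable dense orders without endpoints.
    exact Order.iso_of_countable_dense _ ℚ

theorem isLexDense_blockLanguage_iff (hW : IsPrefixFree W) (hne : ∃ w, w ∈ W) :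
    IsLexDense (blockLanguage W U V) ↔ ∀ u ∈ W, ¬ (u ∈ U ∧ u ∈ V) := by
  constructor
  · rintro ⟨-, hd⟩ u hu ⟨hU, hV⟩
    exact not_densely_ordered_blockLanguage hW hu hU hV hd
  · intro h
    have := blockLanguage_noMax (W := W) (U := U) (V := V)
    have := blockLanguage_nonempty (U := U) (V := V) hne
    obtain ⟨a⟩ := this
    obtain ⟨b, hab⟩ := exists_gt a
    exact ⟨⟨a, b, hab.ne⟩, blockLanguage_densely_ordered hW h⟩

end Blocks

end Lex

/-! ### Paths as unary words. -/

/-- A list of numbers as a binary word: each number in unary, and a final `0`. -/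
def unaryWord : List ℕ → List Bool
  | [] => [false]
  -- The `+ 1` makes every number begin with `1`, so a `0` in that place marks the end of the list;
  -- hence the code is prefix-free.
  | x :: xs => List.replicate (x + 1) true ++ false :: unaryWord xs

theorem replicate_append_prefix {a b : ℕ} {u v : List Bool}
    (h : List.replicate a true ++ false :: u <+: List.replicate b true ++ false :: v) :
    a = b ∧ u <+: v := by
  induction a generalizing b with
  | zero =>
    cases b with
    | zero => exact ⟨rfl, by simpa using h⟩
    | succ b => simp [List.replicate_succ] at h
  | succ a ih =>
    cases b with
    | zero => simp [List.replicate_succ] at h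
    | succ b =>
      have := ih (b := b) (by simpa [List.replicate_succ] using h)
      exact ⟨by rw [this.1], this.2⟩

theorem unaryWord_prefix {xs ys : List ℕ} (h : unaryWord xs <+: unaryWord ys) : xs = ys := by
  induction xs generalizing ys with
  | nil =>
    cases ys with
    | nil => rfl
    | cons y ys => simp [unaryWord, List.replicate_succ] at h
  | cons x xs ih =>
    cases ys with
    | nil => simp [unaryWord, List.replicate_succ] at h
    | cons y ys =>
      obtain ⟨hxy, h⟩ := replicate_append_prefix h
      rw [Nat.succ_injective hxy, ih h]

theorem isPrefixFree_unaryWords (p : List ℕ → Prop) :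
    IsPrefixFree {w | ∃ xs, p xs ∧ w = unaryWord xs} := by
  rintro _ ⟨xs, -, rfl⟩ _ ⟨ys, -, rfl⟩ h
  rw [unaryWord_prefix h]

section Paths

variable {T : List (AffinePiece × AffinePiece)}

/-- Concatenations of blocks `a, b, b', a'` with a step from `(a, b)` to `(a', b')`. -/
inductive LeftPath (T : List (AffinePiece × AffinePiece)) : List ℕ → Prop
  | nil : LeftPath T []
  | cons {a b a' b' : ℕ} {xs : List ℕ} : AffineStep T (a, b) (a', b') → LeftPath T xs →
      LeftPath T (a :: b :: b' :: a' :: xs)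

/-- Concatenations of blocks `b, a, a', b'` with a step from `(a, b)` to `(a', b')`, followed
by `0, 0`. -/
inductive RightPath (T : List (AffinePiece × AffinePiece)) : List ℕ → Prop
  | final : RightPath T [0, 0]
  | cons {a b a' b' : ℕ} {xs : List ℕ} : AffineStep T (a, b) (a', b') → RightPath T xs →
      RightPath T (b :: a :: a' :: b' :: xs)

/-- The list reads `a, b | b₁, a₁ | a₂, b₂ | b₃, a₃ | …`. The left path certifies the steps out of
the pairs in normal order, the right path, shifted by one pair, those out of the reversed pairs. The
reversal nests `b, b'` inside `a, a'`, as a context-free grammar requires. -/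
theorem reaches_of_paths {xs : List ℕ} (hr : RightPath T xs) :
    ∀ {a b : ℕ}, LeftPath T (a :: b :: xs) → Relation.ReflTransGen (AffineStep T) (a, b) (0, 0) := by
  induction hr with
  | final =>
    rintro a b (_ | ⟨h, -⟩)
    exact .single h
  | cons h _ ih =>
    rintro a b (_ | ⟨h', hl⟩)
    exact .head h' (.head h (ih hl))

/-- Left and right steps must alternate. Every genuine step is put on the left and followed by an
idle step on the right, so the parity of the path length is irrelevant. -/
theorem exists_paths_of_reaches (hrefl : ∀ x, AffineStep T x x) {p : ℕ × ℕ}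
    (h : Relation.ReflTransGen (AffineStep T) p (0, 0)) :
    ∃ xs, LeftPath T (p.1 :: p.2 :: xs) ∧ RightPath T xs := by
  induction h using Relation.ReflTransGen.head_induction_on with
  | refl => exact ⟨[0, 0], .cons (hrefl _) .nil, .final⟩
  | @head p q hpq _ ih =>
    obtain ⟨xs, hl, hr⟩ := ih
    exact ⟨_, .cons hpq hl, .cons (hrefl q) hr⟩

end Paths

/-! ### The grammar of the reduction. -/

/-- The nonterminals of the grammars of the reduction. -/
inductive PathNT
  | start
  | dense
  | words
  | block
  | left
  | right
  | rightTail
  | single (p : AffinePiece)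
  | pair (p q : AffinePiece)

namespace AffinePiece

/-- A number that determines an affine piece. -/
def code (p : AffinePiece) : ℕ :=
  Encodable.encode (p.modulus, p.residue, p.slope, p.offset)

theorem code_injective : Function.Injective code := by
  rintro ⟨a, b, c, d⟩ ⟨a', b', c', d'⟩ h
  have := Encodable.encode_injective h
  simp only [Prod.mk.injEq] at this
  simp [this]

end AffinePiece

namespace PathNT

/-- The number that names a nonterminal. -/
def code : PathNT → ℕ
  | start => 0
  | dense => 1
  | words => 2
  | block => 3
  | left => 4
  | right => 5
  | rightTail => 6
  | single p => 2 * p.code + 7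
  | pair p q => 2 * Nat.pair p.code q.code + 8

theorem code_injective : Function.Injective code := by
  intro x y h
  cases x <;> cases y <;> simp only [code] at h <;> first | rfl | omega | skip
  · rename_i p q
    rw [AffinePiece.code_injective (show p.code = q.code by omega)]
  · rename_i p q p' q'
    obtain ⟨h1, h2⟩ := Nat.pair_eq_pair.1
      (show Nat.pair p.code q.code = Nat.pair p'.code q'.code by omega)
    rw [AffinePiece.code_injective h1, AffinePiece.code_injective h2]

/-- The words `1^(x+1) 0 1^(y+1)` for the pairs `(x, y)` of an affine piece. -/
def singleLang (p : AffinePiece) : Language Bool :=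
  {w | ∃ x y, p.Rel x y ∧ w = List.replicate (x + 1) true ++ false :: List.replicate (y + 1) true}

/-- The words `1^(x+1) 0 v 0 1^(y+1)` for the pairs `(x, y)` of the first piece and the words `v` of
the second one. -/
def pairLang (p q : AffinePiece) : Language Bool :=
  {w | ∃ x y, p.Rel x y ∧ ∃ v ∈ singleLang q,
    w = List.replicate (x + 1) true ++ false :: (v ++ false :: List.replicate (y + 1) true)}

/-- All words `unaryWord xs`. -/
def wordsLang : Language Bool := {w | ∃ xs, True ∧ w = unaryWord xs}

/-- The words of left paths. -/
def leftLang (T : List (AffinePiece × AffinePiece)) : Language Bool :=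
  {w | ∃ xs, LeftPath T xs ∧ w = unaryWord xs}

/-- The words of right paths preceded by `s, m`. -/
def rightLang (T : List (AffinePiece × AffinePiece)) (s m : ℕ) : Language Bool :=
  {w | ∃ xs, (∃ ys, RightPath T ys ∧ xs = s :: m :: ys) ∧ w = unaryWord xs}

/-- The language generated from a nonterminal. -/
def lang (T : List (AffinePiece × AffinePiece)) (s m : ℕ) : PathNT → Language Bool
  | start => blockLanguage wordsLang (leftLang T) (rightLang T s m)
  | dense => {w | DenseWord w}
  | words => wordsLang
  -- What remains of a word after a leading `1`, that is, inside a number.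
  | block => {w | true :: w ∈ wordsLang}
  | left => leftLang T
  | right => rightLang T s m
  | rightTail => {w | ∃ xs, RightPath T xs ∧ w = unaryWord xs}
  | single p => singleLang p
  | pair p q => pairLang p q

/-- The last run of ones has no end marker, but its length is a function of `x`, which the first run
determines. -/
theorem isPrefixFree_singleLang (p : AffinePiece) : IsPrefixFree (singleLang p) := by
  rintro _ ⟨x, y, h, rfl⟩ _ ⟨x', y', h', rfl⟩ hp
  obtain ⟨hx, -⟩ := replicate_append_prefix hp
  obtain rfl := Nat.succ_injective hx
  rw [h.right_unique h']

theorem isPrefixFree_pairLang (p q : AffinePiece) : IsPrefixFree (pairLang p q) := by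
  rintro _ ⟨x, y, h, v, hv, rfl⟩ _ ⟨x', y', h', v', hv', rfl⟩ hp
  obtain ⟨hx, hvv⟩ := replicate_append_prefix hp
  obtain rfl := Nat.succ_injective hx
  rw [h.right_unique h', ((isPrefixFree_singleLang q).append_inj hv hv' hvv).1]

theorem isPrefixFree_wordsLang : IsPrefixFree wordsLang := isPrefixFree_unaryWords _

theorem isPrefixFree_lang (T : List (AffinePiece × AffinePiece)) (s m : ℕ) (A : PathNT) :
    IsPrefixFree (lang T s m A) := by
  cases A with
  | start => exact blockLanguage_isPrefixFree isPrefixFree_wordsLang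
  | dense => exact DenseWord.isPrefixFree
  | words => exact isPrefixFree_wordsLang
  | block =>
    intro u hu v hv h
    simpa using isPrefixFree_wordsLang _ hu _ hv (by simpa using h)
  | left => exact isPrefixFree_unaryWords _
  | right => exact isPrefixFree_unaryWords _
  | rightTail => exact isPrefixFree_unaryWords _
  | single p => exact isPrefixFree_singleLang p
  | pair p q => exact isPrefixFree_pairLang p q

/-- The productions for `single p`. -/
def singleRules (p : AffinePiece) : List (PathNT × List (Bool ⊕ PathNT)) :=
  -- The recursive production raises `k` by one, adding `modulus + 1` ones on the left and `slope`
  -- ones on the right; the other one is `k = 0`.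
  [(single p, (List.replicate (p.modulus + 1) true).map .inl ++ ([.inr (single p)] ++
      (List.replicate p.slope true).map .inl)),
    (single p, (List.replicate (p.residue + 1) true ++
      false :: List.replicate (p.offset + 1) true).map .inl)]

/-- The productions for `pair p q`. -/
def pairRules (p q : AffinePiece) : List (PathNT × List (Bool ⊕ PathNT)) :=
  [(pair p q, (List.replicate (p.modulus + 1) true).map .inl ++ ([.inr (pair p q)] ++
      (List.replicate p.slope true).map .inl)),
    (pair p q, (List.replicate (p.residue + 1) true ++ [false]).map .inl ++ ([.inr (single q)] ++
      (false :: List.replicate (p.offset + 1) true).map .inl))]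

/-- The productions that prepend a step to a path. -/
def pathRules (t : AffinePiece × AffinePiece) : List (PathNT × List (Bool ⊕ PathNT)) :=
  [(left, [.inr (pair t.1 t.2), .inl false, .inr left]),
    (rightTail, [.inr (pair t.2 t.1), .inl false, .inr rightTail])]

/-- The productions for one pair of affine pieces. -/
def stepRules (t : AffinePiece × AffinePiece) : List (PathNT × List (Bool ⊕ PathNT)) :=
  pathRules t ++ (singleRules t.1 ++ singleRules t.2 ++ (pairRules t.1 t.2 ++ pairRules t.2 t.1))

/-- The productions that do not depend on the affine system. -/
def baseRules : List (PathNT × List (Bool ⊕ PathNT)) :=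
  [(start, [.inr words, .inl false, .inr dense]),
    (start, [.inr words, .inl true, .inl true, .inl true, .inr dense]),
    (start, [.inr left, .inl true, .inl false]),
    (start, [.inr right, .inl true, .inl true, .inl false]),
    (dense, [.inl false, .inl true]),
    (dense, [.inl false, .inl false, .inr dense]),
    (dense, [.inl true, .inl true, .inr dense]),
    (words, [.inl false]),
    (words, [.inl true, .inr block]),
    (block, [.inl true, .inr block]),
    (block, [.inl false, .inr words]),
    (left, [.inl false]),
    (rightTail, (unaryWord [0, 0]).map .inl)]

/-- The productions that depend on the affine system alone. -/
def fixedRules (T : List (AffinePiece × AffinePiece)) : List (PathNT × List (Bool ⊕ PathNT)) :=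
  baseRules ++ T.flatMap stepRules

/-- The production for `right`. -/
def rightRule (s m : ℕ) : PathNT × List (Bool ⊕ PathNT) :=
  (right, (List.replicate (s + 1) true ++ false :: (List.replicate (m + 1) true ++ [false])).map .inl
    ++ [.inr rightTail])

/-- All productions. -/
def rules (T : List (AffinePiece × AffinePiece)) (s m : ℕ) : List (PathNT × List (Bool ⊕ PathNT)) :=
  rightRule s m :: fixedRules T

/-- A production in terms of the names of the nonterminals. -/
def codeRule (r : PathNT × List (Bool ⊕ PathNT)) : ℕ × List (Bool ⊕ ℕ) :=
  (code r.1, r.2.map (Sum.map id code))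

/-- The grammar of the reduction. -/
def grammar (T : List (AffinePiece × AffinePiece)) (s m : ℕ) : GrammarCode :=
  (code start, (rules T s m).map codeRule)

theorem spells_singleRules {T : List (AffinePiece × AffinePiece)} {s m : ℕ} {p : AffinePiece} :
    ∀ r ∈ singleRules p, ∀ w, Spells (lang T s m) r.2 w → w ∈ lang T s m r.1 := by
  simp only [singleRules, List.forall_mem_cons, Spells.append_iff, Spells.map_inl_iff,
    Spells.singleton_iff, lang, List.not_mem_nil, false_imp_iff, implies_true, and_true]
  constructor
  · rintro _ ⟨_, _, rfl, ⟨_, _, ⟨x, y, ⟨k, rfl, rfl⟩, rfl⟩, rfl, rfl⟩, rfl⟩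
    refine ⟨_, _, ⟨k + 1, rfl, rfl⟩, ?_⟩
    simp only [← List.append_assoc, ← List.replicate_add]
    simp only [List.append_assoc, List.cons_append, ← List.replicate_add]
    congr 2 <;> [skip; congr 1] <;> ring_nf
  · rintro _ rfl
    exact ⟨_, _, ⟨0, rfl, rfl⟩, by simp⟩

theorem spells_pairRules {T : List (AffinePiece × AffinePiece)} {s m : ℕ} {p q : AffinePiece} :
    ∀ r ∈ pairRules p q, ∀ w, Spells (lang T s m) r.2 w → w ∈ lang T s m r.1 := by
  simp only [pairRules, List.forall_mem_cons, Spells.append_iff, Spells.map_inl_iff,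
    Spells.singleton_iff, lang, List.not_mem_nil, false_imp_iff, implies_true, and_true]
  constructor
  · rintro _ ⟨_, _, rfl, ⟨_, _, ⟨x, y, ⟨k, rfl, rfl⟩, v, hv, rfl⟩, rfl, rfl⟩, rfl⟩
    refine ⟨_, _, ⟨k + 1, rfl, rfl⟩, v, hv, ?_⟩
    simp only [← List.append_assoc, ← List.cons_append, ← List.replicate_add]
    simp only [List.append_assoc, List.cons_append, ← List.replicate_add]
    congr 2 <;> [skip; congr 3] <;> ring_nf
  · rintro _ ⟨_, _, rfl, ⟨v, _, hv, rfl, rfl⟩, rfl⟩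
    exact ⟨_, _, ⟨0, rfl, rfl⟩, v, hv, by simp⟩

theorem unaryWord_quad (a b c d : ℕ) (xs : List ℕ) :
    unaryWord (a :: b :: c :: d :: xs) =
      (List.replicate (a + 1) true ++ false :: ((List.replicate (b + 1) true ++
        false :: List.replicate (c + 1) true) ++ false :: List.replicate (d + 1) true)) ++
      false :: unaryWord xs := by
  simp [unaryWord]

theorem leftLang_subset (T : List (AffinePiece × AffinePiece)) : leftLang T ≤ wordsLang :=
  fun _ ⟨xs, _, h⟩ => ⟨xs, trivial, h⟩

theorem rightLang_subset (T : List (AffinePiece × AffinePiece)) (s m : ℕ) :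
    rightLang T s m ≤ wordsLang :=
  fun _ ⟨xs, _, h⟩ => ⟨xs, trivial, h⟩

theorem spells_baseRules {T : List (AffinePiece × AffinePiece)} {s m : ℕ} :
    ∀ r ∈ baseRules, ∀ w, Spells (lang T s m) r.2 w → w ∈ lang T s m r.1 := by
  simp only [baseRules, List.forall_mem_cons, Spells, lang, Spells.map_inl_iff, List.not_mem_nil,
    false_imp_iff, implies_true, and_true]
  refine ⟨?_, ?_, ?_, ?_, ?_, ?_, ?_, ?_, ?_, ?_, ?_, ?_, ?_⟩
  · rintro _ ⟨x, hx, _, ⟨_, ⟨q, hq, _, rfl, rfl⟩, rfl⟩, rfl⟩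
    exact ⟨x, hx, _, .below hq, by simp⟩
  · rintro _ ⟨x, hx, _, ⟨_, ⟨_, ⟨_, ⟨q, hq, _, rfl, rfl⟩, rfl⟩, rfl⟩, rfl⟩, rfl⟩
    exact ⟨x, hx, _, .above hq, by simp⟩
  · rintro _ ⟨x, hx, _, ⟨_, ⟨_, rfl, rfl⟩, rfl⟩, rfl⟩
    exact ⟨x, leftLang_subset T hx, _, .left hx, rfl⟩
  · rintro _ ⟨x, hx, _, ⟨_, ⟨_, ⟨_, rfl, rfl⟩, rfl⟩, rfl⟩, rfl⟩
    exact ⟨x, rightLang_subset T s m hx, _, .right hx, rfl⟩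
  · rintro _ ⟨_, ⟨_, rfl, rfl⟩, rfl⟩
    exact DenseWord.base
  · rintro _ ⟨_, ⟨_, ⟨q, hq, _, rfl, rfl⟩, rfl⟩, rfl⟩
    rw [List.append_nil]
    exact DenseWord.low hq
  · rintro _ ⟨_, ⟨_, ⟨q, hq, _, rfl, rfl⟩, rfl⟩, rfl⟩
    rw [List.append_nil]
    exact DenseWord.high hq
  · rintro _ ⟨_, rfl, rfl⟩
    exact ⟨[], trivial, rfl⟩
  · rintro _ ⟨_, ⟨q, hq, _, rfl, rfl⟩, rfl⟩
    rw [List.append_nil]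
    exact hq
  · rintro _ ⟨_, ⟨q, hq, _, rfl, rfl⟩, rfl⟩
    rw [List.append_nil]
    obtain ⟨xs, -, hxs⟩ := hq
    rcases xs with _ | ⟨x, xs⟩
    · simp [unaryWord] at hxs
    · exact ⟨(x + 1) :: xs, trivial, by
        rw [hxs, unaryWord, unaryWord, List.replicate_succ (n := x + 1), List.cons_append]⟩
  · rintro _ ⟨_, ⟨q, ⟨xs, -, rfl⟩, _, rfl, rfl⟩, rfl⟩
    exact ⟨0 :: xs, trivial, by simp [unaryWord]⟩
  · rintro _ ⟨_, rfl, rfl⟩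
    exact ⟨[], .nil, rfl⟩
  · rintro _ rfl
    exact ⟨_, .final, rfl⟩

theorem spells_pathRules {T : List (AffinePiece × AffinePiece)} {s m : ℕ}
    {t : AffinePiece × AffinePiece} (ht : t ∈ T) :
    ∀ r ∈ pathRules t, ∀ w, Spells (lang T s m) r.2 w → w ∈ lang T s m r.1 := by
  simp only [pathRules, List.forall_mem_cons, Spells, lang, List.not_mem_nil,
    false_imp_iff, implies_true, and_true]
  refine ⟨?_, ?_⟩
  · rintro _ ⟨_, ⟨a, a', ha, _, ⟨b, b', hb, rfl⟩, rfl⟩, _, ⟨_, ⟨_, ⟨xs, hxs, rfl⟩, _, rfl, rfl⟩,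
      rfl⟩, rfl⟩
    exact ⟨_, .cons ⟨t, ht, ha, hb⟩ hxs, by rw [unaryWord_quad, List.append_nil]⟩
  · rintro _ ⟨_, ⟨b, b', hb, _, ⟨a, a', ha, rfl⟩, rfl⟩, _, ⟨_, ⟨_, ⟨xs, hxs, rfl⟩, _, rfl, rfl⟩,
      rfl⟩, rfl⟩
    exact ⟨_, .cons ⟨t, ht, ha, hb⟩ hxs, by rw [unaryWord_quad, List.append_nil]⟩

/-- Soundness: the intended languages are closed under all productions, so they bound the generated
ones from above. -/
theorem spells_rules {T : List (AffinePiece × AffinePiece)} {s m : ℕ} :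
    ∀ r ∈ rules T s m, ∀ w, Spells (lang T s m) r.2 w → w ∈ lang T s m r.1 := by
  intro r hr
  rcases List.mem_cons.1 hr with rfl | hr
  · simp only [rightRule, Spells.append_iff, Spells.map_inl_iff, Spells.singleton_iff]
    rintro _ ⟨_, _, rfl, ⟨ys, hys, rfl⟩, rfl⟩
    exact ⟨_, ⟨ys, hys, rfl⟩, by simp [unaryWord]⟩
  rcases List.mem_append.1 hr with hr | hr
  · exact spells_baseRules r hr
  · obtain ⟨t, ht, hr⟩ := List.mem_flatMap.1 hr
    simp only [stepRules, List.mem_append] at hr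
    rcases hr with hr | (hr | hr) | (hr | hr)
    · exact spells_pathRules ht r hr
    · exact spells_singleRules r hr
    · exact spells_singleRules r hr
    · exact spells_pairRules r hr
    · exact spells_pairRules r hr

section Grammar

variable {T : List (AffinePiece × AffinePiece)} {s m : ℕ}

/-- Numbers that name no nonterminal are assigned the empty language by the existential. -/
theorem languageFrom_grammar_le (n : ℕ) :
    ∀ w ∈ (grammar T s m).toGrammar.languageFrom n, ∃ A, code A = n ∧ w ∈ lang T s m A := by
  refine GrammarCode.languageFrom_le (c := grammar T s m)
    (lang := fun n => {w | ∃ A, code A = n ∧ w ∈ lang T s m A}) (fun p hp w hw => ?_) n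
  obtain ⟨r, hr, rfl⟩ := List.mem_map.1 hp
  refine ⟨r.1, rfl, spells_rules r hr w ?_⟩
  have h := Spells.map_right.1 hw
  have : (fun B => ({w | ∃ A, code A = code B ∧ w ∈ lang T s m A} : Language Bool)) =
      lang T s m := by
    funext B
    ext w
    exact ⟨fun ⟨A, hA, h⟩ => code_injective hA ▸ h, fun h => ⟨B, rfl, h⟩⟩
  rwa [this] at h

/-- Soundness alone suffices: a subset of a prefix-free language is prefix-free. -/
theorem isPrefixGrammar_grammar : (grammar T s m).toGrammar.IsPrefixGrammar := by
  intro n u hu v hv h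
  obtain ⟨A, hA, hu⟩ := languageFrom_grammar_le n u hu
  obtain ⟨B, hB, hv⟩ := languageFrom_grammar_le n v hv
  obtain rfl := code_injective (hA.trans hB.symm)
  exact isPrefixFree_lang T s m A u hu v hv h

/-- The words derived from a nonterminal. -/
def derived (T : List (AffinePiece × AffinePiece)) (s m : ℕ) (A : PathNT) : Language Bool :=
  (grammar T s m).toGrammar.languageFrom (code A)

theorem mem_derived {A : PathNT} {u : List (Bool ⊕ PathNT)} (h : (A, u) ∈ rules T s m)
    {w : List Bool} (hw : Spells (derived T s m) u w) : w ∈ derived T s m A :=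
  GrammarCode.mem_languageFrom_of_spells (c := grammar T s m)
    (List.mem_map.2 ⟨_, h, rfl⟩) (Spells.map_right.2 hw)

theorem mem_rules_of_fixed {r : PathNT × List (Bool ⊕ PathNT)} (h : r ∈ fixedRules T) :
    r ∈ rules T s m := List.mem_cons_of_mem _ h

theorem mem_rules_of_step {t : AffinePiece × AffinePiece} (ht : t ∈ T)
    {r : PathNT × List (Bool ⊕ PathNT)} (h : r ∈ stepRules t) : r ∈ rules T s m :=
  mem_rules_of_fixed (List.mem_append_right _ (List.mem_flatMap.2 ⟨t, ht, h⟩))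

theorem singleLang_le_derived {p : AffinePiece} (hp : ∀ r ∈ singleRules p, r ∈ rules T s m) :
    singleLang p ≤ derived T s m (single p) := by
  rintro _ ⟨_, _, ⟨k, rfl, rfl⟩, rfl⟩
  induction k with
  | zero =>
    refine mem_derived (hp _ (List.mem_cons_of_mem _ List.mem_cons_self)) ?_
    simp [Spells.map_inl_iff, -List.map_append, -List.map_cons]
  | succ k ih =>
    refine mem_derived (hp _ List.mem_cons_self) ?_
    simp only [Spells.append_iff, Spells.map_inl_iff, Spells.singleton_iff]
    refine ⟨_, _, rfl, ⟨_, _, ih, rfl, rfl⟩, ?_⟩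
    simp only [← List.append_assoc, ← List.replicate_add]
    simp only [List.append_assoc, List.cons_append, ← List.replicate_add]
    congr 2 <;> [skip; congr 1] <;> ring_nf

theorem pairLang_le_derived {p q : AffinePiece} (hq : ∀ r ∈ singleRules q, r ∈ rules T s m)
    (hp : ∀ r ∈ pairRules p q, r ∈ rules T s m) : pairLang p q ≤ derived T s m (pair p q) := by
  rintro _ ⟨_, _, ⟨k, rfl, rfl⟩, v, hv, rfl⟩
  induction k with
  | zero =>
    refine mem_derived (hp _ (List.mem_cons_of_mem _ List.mem_cons_self)) ?_
    simp only [Spells.append_iff, Spells.map_inl_iff, Spells.singleton_iff]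
    exact ⟨_, _, rfl, ⟨v, _, singleLang_le_derived hq hv, rfl, rfl⟩, by simp⟩
  | succ k ih =>
    refine mem_derived (hp _ List.mem_cons_self) ?_
    simp only [Spells.append_iff, Spells.map_inl_iff, Spells.singleton_iff]
    refine ⟨_, _, rfl, ⟨_, _, ih, rfl, rfl⟩, ?_⟩
    simp only [← List.append_assoc, ← List.cons_append, ← List.replicate_add]
    simp only [List.append_assoc, List.cons_append, ← List.replicate_add]
    congr 2 <;> [skip; congr 3] <;> ring_nf

theorem dense_le_derived {w : List Bool} (hw : DenseWord w) : w ∈ derived T s m dense := by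
  induction hw with
  | base =>
    exact mem_derived (u := [.inl false, .inl true])
      (mem_rules_of_fixed (by simp [fixedRules, baseRules])) (by simp [Spells])
  | low _ ih =>
    exact mem_derived (u := [.inl false, .inl false, .inr dense])
      (mem_rules_of_fixed (by simp [fixedRules, baseRules])) (by simpa [Spells] using ih)
  | high _ ih =>
    exact mem_derived (u := [.inl true, .inl true, .inr dense])
      (mem_rules_of_fixed (by simp [fixedRules, baseRules])) (by simpa [Spells] using ih)

theorem wordsLang_le_derived : wordsLang ≤ derived T s m words := by
  rintro _ ⟨xs, -, rfl⟩
  induction xs with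
  | nil =>
    exact mem_derived (u := [.inl false]) (mem_rules_of_fixed (by simp [fixedRules, baseRules]))
      (by simp [Spells, unaryWord])
  | cons x xs ih =>
    have hblock : ∀ n, List.replicate n true ++ false :: unaryWord xs ∈ derived T s m block := by
      intro n
      induction n with
      | zero =>
        exact mem_derived (u := [.inl false, .inr words])
          (mem_rules_of_fixed (by simp [fixedRules, baseRules])) ⟨_, ⟨_, ih, _, rfl, rfl⟩, by simp⟩
      | succ n ih =>
        exact mem_derived (u := [.inl true, .inr block])
          (mem_rules_of_fixed (by simp [fixedRules, baseRules]))
          (by simpa [Spells, List.replicate_succ] using ih)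
    exact mem_derived (u := [.inl true, .inr block])
      (mem_rules_of_fixed (by simp [fixedRules, baseRules]))
      (by simpa [Spells, unaryWord, List.replicate_succ] using hblock x)

theorem pair_le_derived {t : AffinePiece × AffinePiece} (ht : t ∈ T) :
    pairLang t.1 t.2 ≤ derived T s m (pair t.1 t.2) :=
  pairLang_le_derived (fun _ h => mem_rules_of_step ht (by simp [stepRules, h]))
    (fun _ h => mem_rules_of_step ht (by simp [stepRules, h]))

theorem pair_swap_le_derived {t : AffinePiece × AffinePiece} (ht : t ∈ T) :
    pairLang t.2 t.1 ≤ derived T s m (pair t.2 t.1) :=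
  pairLang_le_derived (fun _ h => mem_rules_of_step ht (by simp [stepRules, h]))
    (fun _ h => mem_rules_of_step ht (by simp [stepRules, h]))

theorem leftLang_le_derived : leftLang T ≤ derived T s m left := by
  rintro _ ⟨xs, h, rfl⟩
  induction h with
  | nil =>
    exact mem_derived (u := [.inl false]) (mem_rules_of_fixed (by simp [fixedRules, baseRules]))
      (by simp [Spells, unaryWord])
  | cons h _ ih =>
    obtain ⟨t, ht, ha, hb⟩ := h
    refine mem_derived (u := [.inr (pair t.1 t.2), .inl false, .inr left])
      (mem_rules_of_step ht (by simp [stepRules, pathRules])) ?_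
    rw [unaryWord_quad]
    exact ⟨_, pair_le_derived ht ⟨_, _, ha, _, ⟨_, _, hb, rfl⟩, rfl⟩, _,
      ⟨_, ⟨_, ih, _, rfl, rfl⟩, rfl⟩, by rw [List.append_nil]⟩

theorem rightTail_le_derived {xs : List ℕ} (h : RightPath T xs) :
    unaryWord xs ∈ derived T s m rightTail := by
  induction h with
  | final =>
    exact mem_derived (u := (unaryWord [0, 0]).map .inl)
      (mem_rules_of_fixed (by simp [fixedRules, baseRules])) (Spells.map_inl_iff.2 rfl)
  | cons h _ ih =>
    obtain ⟨t, ht, ha, hb⟩ := h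
    refine mem_derived (u := [.inr (pair t.2 t.1), .inl false, .inr rightTail])
      (mem_rules_of_step ht (by simp [stepRules, pathRules])) ?_
    rw [unaryWord_quad]
    exact ⟨_, pair_swap_le_derived ht ⟨_, _, hb, _, ⟨_, _, ha, rfl⟩, rfl⟩, _,
      ⟨_, ⟨_, ih, _, rfl, rfl⟩, rfl⟩, by rw [List.append_nil]⟩

theorem rightLang_le_derived : rightLang T s m ≤ derived T s m right := by
  rintro _ ⟨_, ⟨ys, h, rfl⟩, rfl⟩
  refine mem_derived List.mem_cons_self ?_
  simp only [Spells.append_iff, Spells.map_inl_iff, Spells.singleton_iff]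
  exact ⟨_, _, rfl, rightTail_le_derived h, by simp [unaryWord]⟩

theorem language_grammar :
    (grammar T s m).toGrammar.language =
      blockLanguage wordsLang (leftLang T) (rightLang T s m) := by
  ext w
  constructor
  · intro hw
    obtain ⟨A, hA, h⟩ := languageFrom_grammar_le (code start) w hw
    obtain rfl := code_injective hA
    exact h
  · rintro ⟨x, hx, y, hy, rfl⟩
    change _ ∈ derived T s m start
    cases hy with
    | below hq =>
      refine mem_derived (u := [.inr words, .inl false, .inr dense])
        (mem_rules_of_fixed (by simp [fixedRules, baseRules])) ?_
      exact ⟨_, wordsLang_le_derived hx, _, ⟨_, ⟨_, dense_le_derived hq, _, rfl, rfl⟩, rfl⟩, by simp⟩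
    | above hq =>
      refine mem_derived (u := [.inr words, .inl true, .inl true, .inl true, .inr dense])
        (mem_rules_of_fixed (by simp [fixedRules, baseRules])) ?_
      exact ⟨_, wordsLang_le_derived hx, _,
        ⟨_, ⟨_, ⟨_, ⟨_, dense_le_derived hq, _, rfl, rfl⟩, rfl⟩, rfl⟩, rfl⟩, by simp⟩
    | left hu =>
      refine mem_derived (u := [.inr left, .inl true, .inl false])
        (mem_rules_of_fixed (by simp [fixedRules, baseRules])) ?_
      exact ⟨_, leftLang_le_derived hu, _, ⟨_, ⟨_, rfl, rfl⟩, rfl⟩, rfl⟩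
    | right hv =>
      refine mem_derived (u := [.inr right, .inl true, .inl true, .inl false])
        (mem_rules_of_fixed (by simp [fixedRules, baseRules])) ?_
      exact ⟨_, rightLang_le_derived hv, _, ⟨_, ⟨_, ⟨_, rfl, rfl⟩, rfl⟩, rfl⟩, rfl⟩

theorem disjoint_iff_not_reaches (hrefl : ∀ x, AffineStep T x x) :
    (∀ u ∈ wordsLang, ¬ (u ∈ leftLang T ∧ u ∈ rightLang T s m)) ↔
      ¬ Relation.ReflTransGen (AffineStep T) (s, m) (0, 0) := by
  constructor
  · intro h hreach
    obtain ⟨xs, hl, hr⟩ := exists_paths_of_reaches hrefl hreach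
    exact h _ ⟨_, trivial, rfl⟩ ⟨⟨_, hl, rfl⟩, ⟨_, ⟨xs, hr, rfl⟩, rfl⟩⟩
  · rintro h u - ⟨⟨xs, hl, rfl⟩, ⟨_, ⟨ys, hr, rfl⟩, hxy⟩⟩
    have hp : unaryWord xs <+: unaryWord (s :: m :: ys) := by rw [← hxy]
    obtain rfl := unaryWord_prefix hp
    exact h (reaches_of_paths hr hl)

theorem isLexDense_grammar_iff (hrefl : ∀ x, AffineStep T x x) :
    IsLexDense (grammar T s m).toGrammar.language ↔
      ¬ Relation.ReflTransGen (AffineStep T) (s, m) (0, 0) := by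
  rw [language_grammar, ← disjoint_iff_not_reaches hrefl]
  exact isLexDense_blockLanguage_iff isPrefixFree_wordsLang ⟨_, [], trivial, rfl⟩

theorem hasOrderTypeEta_grammar_iff (hrefl : ∀ x, AffineStep T x x) :
    HasOrderTypeEta (grammar T s m).toGrammar.language ↔
      ¬ Relation.ReflTransGen (AffineStep T) (s, m) (0, 0) := by
  rw [language_grammar, ← disjoint_iff_not_reaches hrefl]
  exact hasOrderTypeEta_blockLanguage_iff isPrefixFree_wordsLang ⟨_, [], trivial, rfl⟩

theorem computable_grammar (T : List (AffinePiece × AffinePiece)) (s : ℕ) {i : ℕ → ℕ}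
    (hi : Computable i) : Computable fun n => grammar T s (i n) := by
  have hrep : Primrec fun n : ℕ => (List.replicate (n + 1) (Sum.inl true) : List (Bool ⊕ ℕ)) := by
    have : Primrec fun n : ℕ => ((List.range (n + 1)).map fun _ => (Sum.inl true : Bool ⊕ ℕ)) :=
      Primrec.list_map (Primrec.list_range.comp Primrec.succ) (Primrec.const _).to₂
    exact this.of_eq fun n => by simp
  have hrule : Primrec fun n : ℕ => codeRule (rightRule s n) := by
    -- Only the production for `right` depends on `n`; `5` and `6` are the codes of `right` and
    -- `rightTail`.
    have : Primrec fun n : ℕ => ((5, (List.replicate (s + 1) (Sum.inl true) ++ [Sum.inl false]) ++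
        (List.replicate (n + 1) (Sum.inl true) ++ [Sum.inl false, Sum.inr 6])) :
        ℕ × List (Bool ⊕ ℕ)) :=
      Primrec.pair (Primrec.const _) (Primrec.list_append.comp (Primrec.const _)
        (Primrec.list_append.comp hrep (Primrec.const _)))
    refine this.of_eq fun n => ?_
    simp [codeRule, rightRule, code]
  have : Primrec fun n : ℕ => grammar T s n :=
    Primrec.pair (Primrec.const _) (Primrec.list_cons.comp hrule (Primrec.const _))
  exact this.to_comp.comp hi

end Grammar

end PathNT

/-! ### Undecidability by reduction. -/

/-- The image of `g` satisfies the promise `P`, so composing the partial algorithm with `g` gives a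
total one. -/
theorem DecidableByAlgorithmOn.computablePred_comp {α β : Type} [Primcodable α] [Primcodable β]
    {P Q : β → Prop} (h : DecidableByAlgorithmOn P Q) {g : α → β} (hg : Computable g)
    (hP : ∀ a, P (g a)) : ComputablePred fun a => Q (g a) := by
  classical
  obtain ⟨f, hf, hfQ⟩ := h
  refine ⟨Classical.decPred _, (hf.comp hg).of_eq_tot fun a => ?_⟩
  obtain ⟨b, hb, hbQ⟩ := hfQ (g a) (hP a)
  have : decide (Q (g a)) = b := by rw [Bool.eq_iff_iff, hbQ, decide_eq_true_iff]
  rwa [this]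

theorem ComputablePred.decidableByAlgorithmOn {α : Type} [Primcodable α] {Q : α → Prop}
    (h : ComputablePred Q) (P : α → Prop) : DecidableByAlgorithmOn P Q := by
  obtain ⟨_, h⟩ := h
  exact ⟨_, h.partrec, fun x _ => ⟨_, Part.mem_some _, decide_eq_true_iff⟩⟩

theorem not_decidableByAlgorithmOn_prefixGrammars {Q : GrammarCode → Prop}
    (hQ : ∀ T s m, (∀ x, AffineStep T x x) → (Q (PathNT.grammar T s m) ↔
      ¬ Relation.ReflTransGen (AffineStep T) (s, m) (0, 0))) :
    ¬ DecidableByAlgorithmOn (fun c : GrammarCode => c.toGrammar.IsPrefixGrammar) Q := by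
  intro h
  obtain ⟨T, s, i, hrefl, hi, hund⟩ := exists_undecidable_affine
  refine hund (((h.computablePred_comp (PathNT.computable_grammar T s hi)
    fun n => PathNT.isPrefixGrammar_grammar).not).of_eq fun n => ?_)
  rw [hQ T s (i n) hrefl, not_not]

theorem theorem1 :
    (¬ ComputablePred fun c : GrammarCode => IsLexDense c.toGrammar.language) ∧
    (¬ DecidableByAlgorithmOn (fun c : GrammarCode => c.toGrammar.IsPrefixGrammar)
        (fun c : GrammarCode => IsLexDense c.toGrammar.language)) ∧
    (¬ ComputablePred fun c : GrammarCode => HasOrderTypeEta c.toGrammar.language) ∧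
    (¬ DecidableByAlgorithmOn (fun c : GrammarCode => c.toGrammar.IsPrefixGrammar)
        (fun c : GrammarCode => HasOrderTypeEta c.toGrammar.language)) := by
  have hdense := not_decidableByAlgorithmOn_prefixGrammars
    (Q := fun c => IsLexDense c.toGrammar.language)
    fun _ _ _ => PathNT.isLexDense_grammar_iff
  have heta := not_decidableByAlgorithmOn_prefixGrammars
    (Q := fun c => HasOrderTypeEta c.toGrammar.language)
    fun _ _ _ => PathNT.hasOrderTypeEta_grammar_iff
  exact ⟨fun h => hdense (h.decidableByAlgorithmOn _), hdense,
    fun h => heta (h.decidableByAlgorithmOn _), heta⟩
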